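/- Let $G$ be a compact topological group acting continuously by homeomorphisms on a Hausdorff space $\mathcal X$. Assume that the action is separating, i.e. $\mathcal X$ is infinite and for every finite $Y\subset\mathcal X$ the pointwise stabilizer of $Y$ in $G$ fixes no point of $\mathcal X\setminus Y$. Let $t\in\mathbb N$, let $\mathbb F_t$ be the free group on $y_1,\dots,y_t$, and let $w(\bar y)\in\mathbb F_t*G$ be a word which either lies in $\mathbb F_t$, or does not lie in $\mathbb F_t$ and is given by a reduced expression $$w(\bar y)=u_nv_nu_{n-1}v_{n-1}\cdots u_1v_1,\qquad u_i\in\mathbb F_t,\quad v_i\in G\setminus\{1\},$$ where reduced means that $u_i\neq1$ for $i<n$. Put $O_w=\mathcal X\setminus\mathrm{Fix}(G)$ if $w\in\mathbb F_t$, where $\mathrm{Fix}(G)$ is the set of points fixed by all of $G$, and $$O_w=\bigcap_{i=0}^{n-1}v_1^{-1}\cdots v_i^{-1}\bigl(\mathrm{supp}(v_{i+1})\bigr)$$ otherwise, where $\mathrm{supp}(v)=\{x\in\mathcal X: v(x)\neq x\}$. The word $w$ is called explicitly oscillating if $w\neq 1$ in $\mathbb F_t*G$ and $O_w\neq\emptyset$.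 If $w$ is explicitly oscillating and $O_w=\mathcal X$, then for a random $t$-tuple $\bar\gamma=(\gamma_1,\dots,\gamma_t)$ from $G$ (independent entries, each distributed according to the normalized Haar measure of $G$) one has $w(\bar\gamma)\neq1$ almost surely. -/

import Mathlib

open MeasureTheory MeasureTheory.Measure
open scoped Pointwise

/-- A word with constants from `G` in the variables `y_1, …, y_t`, i.e. an element of the free
product `𝔽_t ∗ G`. -/
abbrev MixedWord (t : ℕ) (G : Type*) [Group G] : Type _ :=
  Monoid.Coprod (FreeGroup (Fin t)) G

namespace MixedWord

variable {t : ℕ} {G : Type*} [Group G]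

/-- The value `w(γ_1, …, γ_t) ∈ G` of the word `w` at a `t`-tuple `γ` of elements of `G`. -/
def eval (γ : Fin t → G) : MixedWord t G →* G :=
  Monoid.Coprod.lift (FreeGroup.lift γ) (MonoidHom.id G)

/-- `w ∈ 𝔽_t`, i.e. `w` has no constants. -/
def IsFree (w : MixedWord t G) : Prop :=
  ∃ u : FreeGroup (Fin t), w = Monoid.Coprod.inl u

/-- `w = u_n v_n u_{n-1} v_{n-1} ⋯ u_1 v_1` is a reduced expression in `𝔽_t ∗ G` with constants
`v_i ∈ G ∖ {1}` and `u_i ∈ 𝔽_t`. Reducedness says that `u_i ≠ 1` between two constants, i.e. for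
`i < n`. Indices are shifted: the Lean `u i`, `v i` with `i : Fin n` are `u_{i+1}`, `v_{i+1}`. -/
def IsReducedForm (w : MixedWord t G) (n : ℕ) (u : Fin n → FreeGroup (Fin t)) (v : Fin n → G) :
    Prop :=
  (∀ i, v i ≠ 1) ∧
  (∀ i : Fin n, (i : ℕ) + 1 < n → u i ≠ 1) ∧
  w = (List.ofFn fun i => Monoid.Coprod.inl (u i) * Monoid.Coprod.inr (v i)).reverse.prod

variable (X : Type*) [MulAction G X]

/-- The support `{x | g x ≠ x}` of a group element. -/
def supp (g : G) : Set X := {x | g • x ≠ x}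

/-- `⋂_{i=0}^{n-1} v_1⁻¹ ⋯ v_i⁻¹ (supp v_{i+1})` for a sequence `v_1, …, v_n` of constants. -/
def regionOfConstants {n : ℕ} (v : Fin n → G) : Set X :=
  ⋂ i : Fin n, ((List.ofFn fun j => (v j)⁻¹).take i).prod • supp X (v i)

variable {X}

/-- `O` is the set `O_w` attached to the word `w`: the complement of the set of global fixed points
if `w ∈ 𝔽_t`, and the intersection of translated supports read off from the reduced expression
`w = u_n v_n ⋯ u_1 v_1` if `w ∉ 𝔽_t`. (If `w ∉ 𝔽_t` has no expression of this shape,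
then `O_w` is not defined and no `O` satisfies this.) -/
def IsRegion (w : MixedWord t G) (O : Set X) : Prop :=
  (w.IsFree ∧ O = (MulAction.fixedPoints G X)ᶜ) ∨
  (¬ w.IsFree ∧ ∃ (n : ℕ) (u : Fin n → FreeGroup (Fin t)) (v : Fin n → G),
    w.IsReducedForm n u v ∧ O = regionOfConstants X v)

/-- `w` is explicitly oscillating in `V`: it is non-trivial and `V ∩ O_w ≠ ∅`. -/
def IsExplicitlyOscillatingIn (w : MixedWord t G) (V : Set X) : Prop :=
  w ≠ 1 ∧ ∃ O : Set X, w.IsRegion O ∧ (V ∩ O).Nonempty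

variable (X) in
/-- `w` is explicitly oscillating (in the whole space). -/
def IsExplicitlyOscillating (w : MixedWord t G) : Prop :=
  w.IsExplicitlyOscillatingIn (Set.univ : Set X)

end MixedWord

/-- `G` separates the infinite set `X`: for every finite `Y ⊆ X`, the pointwise stabilizer of `Y`
fixes no point outside `Y`. -/
def Separates (G X : Type*) [Group G] [MulAction G X] : Prop :=
  Infinite X ∧ ∀ Y : Finset X, ∀ x ∉ Y, ∃ g ∈ fixingSubgroup G (Y : Set X), g • x ≠ x

/-- The law of a random `t`-tuple from a compact group `G`: `t` independent elements, each
distributed according to the Haar measure of total mass `1`. -/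
noncomputable def randomTuple (t : ℕ) (G : Type*) [Group G] [TopologicalSpace G]
    [IsTopologicalGroup G] [CompactSpace G] [MeasurableSpace G] [BorelSpace G] :
    Measure (Fin t → G) :=
  Measure.pi fun _ => haarMeasure (⊤ : TopologicalSpace.PositiveCompacts G)

/-! Fix a point `x` and follow it along the letters of `w`, revealing the random tuple only where
the trajectory queries it. At each stage finitely many values are known: the tuple is `g * h` with
`g` fixed and `h` Haar random in the compact group `tupleFixingSubgroup G Y`. By separation, a point
outside `Y j` has an infinite orbit under the `j`-th coordinate of that group
(`Separates.infinite_range_smul`), so its image almost surely avoids any prescribed finite set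
(`haarNull_setOf_smul_eq`). Each new point can therefore be kept away from all earlier ones, also
after a following constant is applied. Since `O_w` is the whole space, the constants have no fixed
points, so they do not stop the trajectory either; it ends away from `x`, whence `w(γ) ≠ 1`. This
induction is `haarNull_setOf_lettersValue_smul_eq`. Conditioning on a revealed value means passing
to cosets of a smaller stabilizer; `HaarNull.of_fibers` justifies this without countability
assumptions on `G`. `HaarNull.measure_pi_eq_zero` returns to the product measure. -/

/-! ### Null sets in compact groups. -/

section CompactGroup

open Set Topology

/-- A subset of a compact group is Haar null if every left invariant Borel probability measure
gives it measure zero. -/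
structure HaarNull {K : Type*} [Group K] [TopologicalSpace K] (B : Set K) : Prop where
  measure_eq_zero : ∀ [MeasurableSpace K] [BorelSpace K]
    (μ : Measure K) [IsProbabilityMeasure μ]
    [μ.IsMulLeftInvariant], μ B = 0

theorem HaarNull.mono {K : Type*} [Group K] [TopologicalSpace K] {A B : Set K} (hB : HaarNull B)
    (h : A ⊆ B) : HaarNull A :=
  ⟨fun μ _ _ => measure_mono_null h (hB.measure_eq_zero μ)⟩

theorem HaarNull.biUnion_finite {K ι : Type*} [Group K] [TopologicalSpace K] {S : Set ι}
    (hS : S.Finite) {B : ι → Set K} (hB : ∀ i ∈ S, HaarNull (B i)) :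
    HaarNull (⋃ i ∈ S, B i) :=
  ⟨fun μ _ _ => (measure_biUnion_null_iff hS.countable).2 fun i hi => (hB i hi).measure_eq_zero μ⟩

theorem haarNull_empty {K : Type*} [Group K] [TopologicalSpace K] : HaarNull (∅ : Set K) :=
  ⟨fun _ _ _ => measure_empty⟩

/-- An invariant probability measure pushes forward to another one along a surjective homomorphism.
As `B` need not be measurable, only the inequality `le_map_apply` is available, and it suffices. -/
theorem HaarNull.preimage {K L : Type*} [Group K] [TopologicalSpace K]
    [IsTopologicalGroup K] [Group L] [TopologicalSpace L] [IsTopologicalGroup L] {B : Set L}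
    (hB : HaarNull B) (f : K →* L) (hf : Continuous f) (hs : Function.Surjective f) :
    HaarNull (f ⁻¹' B) := by
  constructor
  intro _ _ μ _ _
  let : MeasurableSpace L := borel L
  have : BorelSpace L := ⟨rfl⟩
  have hp : IsProbabilityMeasure (μ.map f) := isProbabilityMeasure_map (by fun_prop)
  have hi : (μ.map f).IsMulLeftInvariant := isMulLeftInvariant_map f.toMulHom hf.measurable hs
  exact le_antisymm
    ((le_map_apply hf.aemeasurable B).trans (hB.measure_eq_zero (μ.map f)).le) zero_le

variable {K L : Type*} [Group K] [TopologicalSpace K] [IsTopologicalGroup K] [CompactSpace K]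
  [Group L] [TopologicalSpace L] [IsTopologicalGroup L]

instance isProbabilityMeasure_haarMeasure_top [MeasurableSpace K] [BorelSpace K] :
    IsProbabilityMeasure (haarMeasure (⊤ : TopologicalSpace.PositiveCompacts K)) :=
  ⟨by simpa using haarMeasure_self (K₀ := (⊤ : TopologicalSpace.PositiveCompacts K))⟩

/-- A finite left invariant measure on a compact group is a multiple of any left invariant
probability measure. -/
theorem measure_eq_univ_smul_of_isMulLeftInvariant [MeasurableSpace K] [BorelSpace K]
    (μ ν : Measure K) [IsProbabilityMeasure μ] [μ.IsMulLeftInvariant] [IsFiniteMeasure ν]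
    [ν.IsMulLeftInvariant] : ν = ν univ • μ := by
  have key (ρ : Measure K) [IsFiniteMeasure ρ] [ρ.IsMulLeftInvariant] :
      ρ = ρ univ • haarMeasure (⊤ : TopologicalSpace.PositiveCompacts K) := by
    have h := isMulInvariant_eq_smul_of_compactSpace ρ
      (haarMeasure (⊤ : TopologicalSpace.PositiveCompacts K))
    generalize ρ.haarScalarFactor (haarMeasure (⊤ : TopologicalSpace.PositiveCompacts K)) = c at h
    have h2 : ρ univ = c := by
      rw [h, Measure.smul_apply, measure_univ, ENNReal.smul_def, smul_eq_mul, mul_one]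
    rw [h2]
    exact h
  have hμ := key μ
  rw [measure_univ, one_smul] at hμ
  rw [hμ]
  exact key ν

theorem eq_of_isMulLeftInvariant [MeasurableSpace K] [BorelSpace K]
    (μ ν : Measure K) [IsProbabilityMeasure μ] [μ.IsMulLeftInvariant] [IsProbabilityMeasure ν]
    [ν.IsMulLeftInvariant] : ν = μ := by
  have := measure_eq_univ_smul_of_isMulLeftInvariant μ ν
  rwa [measure_univ, one_smul] at this

/-- A right translate of `μ` is again a left invariant probability measure, so uniqueness applies.
-/
theorem isMulRightInvariant_of_compactSpace [MeasurableSpace K] [BorelSpace K]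
    (μ : Measure K) [IsProbabilityMeasure μ] [μ.IsMulLeftInvariant] : μ.IsMulRightInvariant := by
  refine ⟨fun k => ?_⟩
  have : IsProbabilityMeasure (μ.map (· * k)) :=
    isProbabilityMeasure_map (by fun_prop)
  exact eq_of_isMulLeftInvariant _ _

/-- Urysohn's lemma separates `B` from the compact image of the complement of a small open
neighbourhood of `φ ⁻¹' B`. -/
theorem HaarNull.exists_continuous_integral_lt {L : Type*} [TopologicalSpace L] [RegularSpace L]
    [LocallyCompactSpace L] [MeasurableSpace K] [BorelSpace K]
    (μ : Measure K) [IsProbabilityMeasure μ]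
    [μ.IsMulLeftInvariant] {φ : K → L} (hφ : Continuous φ) {B : Set L}
    (hB : IsClosed B) (hnull : HaarNull (φ ⁻¹' B)) {ε : ℝ} (hε : 0 < ε) :
    ∃ f : C(L, ℝ), (∀ x, f x ∈ Icc (0 : ℝ) 1) ∧ EqOn f 1 B ∧ ∫ k, f (φ k) ∂μ < ε := by
  obtain ⟨U, hBU, hU, hUε⟩ := Set.exists_isOpen_lt_of_lt (μ := μ) (φ ⁻¹' B) (ENNReal.ofReal ε)
    (by rw [hnull.measure_eq_zero μ]; simpa using hε)
  obtain ⟨f, hf0, hf1, hf⟩ := exists_continuous_zero_one_of_isCompact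
    (hU.isClosed_compl.isCompact.image hφ) hB (by
      rw [Set.disjoint_left]
      rintro _ ⟨k, hk, rfl⟩ hkB
      exact hk (hBU hkB))
  refine ⟨f, hf, hf1, ?_⟩
  have hle : ∀ k, f (φ k) ≤ U.indicator 1 k := fun k => by
    by_cases hk : k ∈ U
    · simpa [hk] using (hf (φ k)).2
    · simpa [hk] using (hf0 (mem_image_of_mem φ hk)).le
  calc ∫ k, f (φ k) ∂μ ≤ ∫ k, U.indicator 1 k ∂μ := by
        refine integral_mono_of_nonneg (.of_forall fun k => (hf _).1) ?_ (.of_forall hle)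
        exact (integrable_const (1 : ℝ)).indicator hU.measurableSet
    _ = μ.real U := integral_indicator_one hU.measurableSet
    _ < ε := by
        rw [Measure.real]
        exact (ENNReal.toReal_lt_toReal (measure_ne_top _ _) ENNReal.ofReal_ne_top).2 hUε |>.trans_eq
          (ENNReal.toReal_ofReal hε.le)

/-- Weil's formula as a criterion for null sets: let `a` and `b` be continuous maps from a compact
group `K` to a compact group `L`. If, for `x` outside a null set, `a k * x * b k` almost
surely avoids the closed set `B`, then `B` is null. -/
theorem HaarNull.of_fibers [CompactSpace L] {a b : K → L} (ha : Continuous a) (hb : Continuous b)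
    {E B : Set L} (hE : HaarNull E) (hB : IsClosed B)
    (h : ∀ x ∉ E, HaarNull {k | a k * x * b k ∈ B}) : HaarNull B := by
  classical
  constructor
  intro _ _ ν _ _
  let : MeasurableSpace K := borel K
  have : BorelSpace K := ⟨rfl⟩
  set μ := haarMeasure (⊤ : TopologicalSpace.PositiveCompacts K)
  have hν := isMulRightInvariant_of_compactSpace ν
  have hcont (f : C(L, ℝ)) : Continuous fun x => ∫ k, f (a k * x * b k) ∂μ := by
    rw [← continuousOn_univ]
    refine continuousOn_integral_of_compact_support (k := univ) isCompact_univ ?_ (by simp)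
    exact Continuous.continuousOn (by simp only [Function.uncurry_def]; fun_prop)
  -- Fubini is used only for continuous functions, since the Borel σ-algebra of a product may exceed
  -- the product σ-algebra. The inner integral is then constant in `k` by two-sided invariance.
  have hint (f : C(L, ℝ)) : ∫ x, ∫ k, f (a k * x * b k) ∂μ ∂ν = ∫ x, f x ∂ν := by
    rw [integral_integral_swap_of_hasCompactSupport (f := fun x k => f (a k * x * b k))]
    · have (k : K) : ∫ x, f (a k * x * b k) ∂ν = ∫ x, f x ∂ν := by
        rw [integral_mul_left_eq_self (μ := ν) fun x => f (x * b k),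
          integral_mul_right_eq_self (μ := ν) fun x => f x]
      simp [this]
    · simp only [Function.uncurry_def]; fun_prop
    · exact HasCompactSupport.of_compactSpace _
  have hik (f : C(L, ℝ)) (x : L) : Integrable (fun k => f (a k * x * b k)) μ :=
    Continuous.integrable_of_hasCompactSupport (by fun_prop) (HasCompactSupport.of_compactSpace _)
  rw [← nonpos_iff_eq_zero]
  refine ENNReal.le_of_forall_pos_le_add fun ε hε _ => ?_
  rw [zero_add]
  obtain ⟨U, hEU, hU, hUε⟩ := Set.exists_isOpen_lt_of_lt (μ := ν) E (ENNReal.ofReal (ε / 2))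
    (by rw [hE.measure_eq_zero ν]; simpa using hε)
  have hchoice (x : L) : ∃ f : C(L, ℝ), (∀ y, f y ∈ Icc (0 : ℝ) 1) ∧ EqOn f 1 B ∧
      (x ∉ E → ∫ k, f (a k * x * b k) ∂μ < ε / 2) := by
    by_cases hx : x ∈ E
    · exact ⟨1, by simp, fun y _ => rfl, fun h => absurd hx h⟩
    · obtain ⟨f, h1, h2, h3⟩ := HaarNull.exists_continuous_integral_lt μ (φ := fun k => a k * x * b k)
        (by fun_prop) hB (h x hx) (ε := ε / 2) (by positivity)
      exact ⟨f, h1, h2, fun _ => h3⟩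
  choose F hF01 hF1 hFε using hchoice
  -- Off `U`, finitely many of the functions `F x` suffice to make some fibre integral small at
  -- every point; their product is still `1` on `B` and lies below each of them.
  obtain ⟨s, hs⟩ := hU.isClosed_compl.isCompact.elim_finite_subcover
    (fun x : (Eᶜ : Set L) => {y | ∫ k, F x (a k * y * b k) ∂μ < ε / 2})
    (fun x => isOpen_lt (hcont _) continuous_const)
    (fun x hx => mem_iUnion.2 ⟨⟨x, fun h => hx (hEU h)⟩, hFε x fun h => hx (hEU h)⟩)
  set f : C(L, ℝ) := ∏ x ∈ s, F x
  have hfapp (y : L) : f y = ∏ x ∈ s, F x y := by simp [f]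
  have hf01 (y : L) : f y ∈ Icc (0 : ℝ) 1 := by
    rw [hfapp]
    exact ⟨Finset.prod_nonneg fun x _ => (hF01 x y).1,
      Finset.prod_le_one (fun x _ => (hF01 x y).1) fun x _ => (hF01 x y).2⟩
  have hf1 : EqOn f 1 B := fun y hy => by
    rw [hfapp]
    exact Finset.prod_eq_one fun x _ => hF1 x hy
  have hfle (x) (hx : x ∈ s) (y : L) : f y ≤ F x y := by
    rw [hfapp, ← Finset.mul_prod_erase _ _ hx]
    exact mul_le_of_le_one_right (hF01 x y).1
      (Finset.prod_le_one (fun x _ => (hF01 x y).1) fun x _ => (hF01 x y).2)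
  have hpt (x : L) : ∫ k, f (a k * x * b k) ∂μ ≤ ε / 2 + U.indicator 1 x := by
    by_cases hx : x ∈ U
    · have : ∫ k, f (a k * x * b k) ∂μ ≤ ∫ k, (1 : ℝ) ∂μ :=
        integral_mono (hik f x) (integrable_const _) fun k => (hf01 _).2
      simp only [hx, indicator_of_mem, Pi.one_apply]
      simp only [integral_const, probReal_univ, smul_eq_mul, mul_one] at this
      have : (0 : ℝ) < ε := hε
      linarith
    · obtain ⟨y, hy, hxy⟩ := mem_iUnion₂.1 (hs hx)
      simp only [hx, not_false_eq_true, indicator_of_notMem, add_zero]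
      exact (integral_mono (hik f x) (hik (F y) x) fun k => hfle y hy _).trans hxy.le
  have hUi : Integrable (U.indicator (1 : L → ℝ)) ν :=
    (integrable_const (1 : ℝ)).indicator hU.measurableSet
  have hfε : ∫ x, f x ∂ν ≤ ε := by
    rw [← hint]
    calc ∫ x, ∫ k, f (a k * x * b k) ∂μ ∂ν ≤ ∫ x, ((ε : ℝ) / 2 + U.indicator 1 x) ∂ν :=
          integral_mono_of_nonneg (.of_forall fun x => integral_nonneg fun k => (hf01 _).1)
            ((integrable_const _).add hUi) (.of_forall hpt)
      _ = ε / 2 + ν.real U := by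
          rw [integral_add (integrable_const _) hUi, integral_indicator_one hU.measurableSet]
          simp
      _ ≤ ε := by
          have := (ENNReal.toReal_lt_toReal (measure_ne_top _ _) ENNReal.ofReal_ne_top).2 hUε
          rw [ENNReal.toReal_ofReal (by positivity)] at this
          rw [Measure.real]
          linarith
  have hBf : ν.real B ≤ ∫ x, f x ∂ν := by
    rw [← integral_indicator_one hB.measurableSet]
    refine integral_mono_of_nonneg (.of_forall fun x => indicator_nonneg (by simp) x)
      (f.continuous.integrable_of_hasCompactSupport (HasCompactSupport.of_compactSpace _))
      (.of_forall fun x => ?_)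
    by_cases hx : x ∈ B
    · simp [hx, hf1 hx]
    · simpa [hx] using (hf01 x).1
  rw [← ENNReal.toReal_le_toReal (measure_ne_top _ _) ENNReal.coe_ne_top]
  exact hBf.trans hfε

/-- If the orbit of `s` is infinite, then almost every group element does not map `s` to a given
point. -/
theorem haarNull_setOf_smul_eq {G X : Type*} [TopologicalSpace X] [T1Space X] [Group G]
    [TopologicalSpace G] [MulAction G X] [ContinuousSMul G X] (ψ : L →* G) (hψ : Continuous ψ)
    {s : X} (hs : (range fun h => ψ h • s).Infinite) (q : X) : HaarNull {h : L | ψ h • s = q} := by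
  constructor
  intro _ _ μ _ _
  by_cases hq : q ∈ range fun h => ψ h • s
  · have hclosed (r : X) : IsClosed {h : L | ψ h • s = r} :=
      isClosed_singleton.preimage (hψ.smul continuous_const : Continuous fun h : L => ψ h • s)
    -- The fibres over the orbit are translates of each other. Infinitely many disjoint sets of
    -- equal positive measure cannot fit in a finite measure.
    have hmeas (r : range fun h => ψ h • s) :
        μ {h : L | ψ h • s = r} = μ {h : L | ψ h • s = q} := by
      obtain ⟨⟨_, a, rfl⟩, ⟨b, rfl⟩⟩ := r, hq
      simp only
      rw [← measure_preimage_mul μ (a * b⁻¹)]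
      congr 1
      ext h
      simp only [mem_preimage, mem_ofPred_eq, mul_smul, map_mul, map_inv]
      rw [smul_left_cancel_iff, inv_smul_eq_iff]
    by_contra hne
    have hfin := finite_const_le_meas_of_disjoint_iUnion μ (pos_iff_ne_zero.2 hne)
      (As := fun r : range fun h => ψ h • s => {h : L | ψ h • s = r})
      (fun r => (hclosed r).measurableSet)
      (fun r r' hrr => Set.disjoint_left.2 fun h h1 h2 => hrr (Subtype.ext (h1.symm.trans h2)))
      (measure_ne_top _ _)
    have : Infinite (range fun h => ψ h • s) := hs.to_subtype
    refine Set.infinite_univ (hfin.subset fun r _ => ?_)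
    exact (hmeas r).ge
  · convert measure_empty (μ := μ)
    ext h
    simp only [mem_ofPred_eq, mem_empty_iff_false, iff_false]
    rintro rfl
    exact hq ⟨h, rfl⟩

end CompactGroup

/-! ### Borel and product σ-algebras on powers of `G`. -/

section PowerOfCompactGroup

open Set Topology

variable {ι G : Type*} [Fintype ι] [Group G] [TopologicalSpace G] [IsTopologicalGroup G]
  [CompactSpace G] [MeasurableSpace G] [BorelSpace G]

/-- A left invariant probability measure on a power of a compact group, defined on the product
of the Borel σ-algebras, is the product of the Haar measures. -/
theorem pi_haarMeasure_eq_of_isMulLeftInvariant (ν : Measure (ι → G)) [IsProbabilityMeasure ν]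
    [ν.IsMulLeftInvariant] :
    Measure.pi (fun _ => haarMeasure (⊤ : TopologicalSpace.PositiveCompacts G)) = ν := by
  classical
  set μ := haarMeasure (⊤ : TopologicalSpace.PositiveCompacts G)
  have key (S : ι → Set G) (hS : ∀ i, MeasurableSet (S i)) (s : Finset ι) :
      ν ((s : Set ι).pi S) = ∏ i ∈ s, μ (S i) := by
    induction s using Finset.induction_on with
    | empty => simp
    | insert j s hj ih =>
      set C := (s : Set ι).pi S with hC
      have hCm : MeasurableSet C := MeasurableSet.pi s.countable_toSet fun i _ => hS i
      have hev : Measurable fun γ : ι → G => γ j := measurable_pi_apply j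
      -- Translating only coordinate `j` preserves `C`, so `ρ` is left invariant, hence `ν C` times
      -- Haar measure.
      set ρ := (ν.restrict C).map (fun γ => γ j) with hρ
      have hρinv : ρ.IsMulLeftInvariant := by
        refine ⟨fun g => ?_⟩
        ext A hA
        rw [map_apply (by fun_prop) hA, hρ, map_apply hev (measurableSet_preimage (by fun_prop) hA),
          map_apply hev hA,
          Measure.restrict_apply (hev (measurableSet_preimage (by fun_prop) hA)),
          Measure.restrict_apply (hev hA),
          ← measure_preimage_mul ν (Pi.mulSingle j g) ((fun γ : ι → G => γ j) ⁻¹' A ∩ C)]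
        congr 1
        ext γ
        simp only [mem_inter_iff, mem_preimage, Pi.mul_apply, Pi.mulSingle_eq_same, hC, mem_pi]
        refine and_congr_right fun _ => forall₂_congr fun i hi => ?_
        rw [Pi.mulSingle_eq_of_ne (by rintro rfl; exact hj hi), one_mul]
      have hρuniv : ρ univ = ∏ i ∈ s, μ (S i) := by
        rw [hρ, map_apply hev MeasurableSet.univ, preimage_univ, restrict_apply_univ, ih]
      have h := congrArg (fun m => m (S j)) (measure_eq_univ_smul_of_isMulLeftInvariant μ ρ)
      simp only [Measure.smul_apply, hρuniv, smul_eq_mul] at h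
      rw [Finset.prod_insert hj, mul_comm, ← h, hρ, map_apply hev (hS j),
        Measure.restrict_apply (hev (hS j)), Finset.coe_insert, insert_pi]
  refine Measure.pi_eq fun S hS => ?_
  rw [← key S hS Finset.univ, Finset.coe_univ]

/-- In a product of topological spaces, a compact subset of an open set is contained in a finite
union of open boxes inside the open set. -/
theorem IsCompact.exists_measurableSet_pi {ι G : Type*} [TopologicalSpace G]
    [MeasurableSpace G] [OpensMeasurableSpace G] {B U : Set (ι → G)} (hB : IsCompact B)
    (hU : IsOpen U) (hBU : B ⊆ U) : ∃ V, B ⊆ V ∧ V ⊆ U ∧ MeasurableSet V := by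
  refine hB.induction_on (p := fun B => ∃ V, B ⊆ V ∧ V ⊆ U ∧ MeasurableSet V)
    ⟨∅, by simp⟩ (fun s t hst ⟨V, h1, h2⟩ => ⟨V, hst.trans h1, h2⟩)
    (fun s t ⟨V, h1, h2, h3⟩ ⟨W, h4, h5, h6⟩ =>
      ⟨V ∪ W, union_subset_union h1 h4, union_subset h2 h5, h3.union h6⟩) fun x hx => ?_
  obtain ⟨I, u, hu, hIU⟩ := isOpen_pi_iff.1 hU x (hBU hx)
  refine ⟨(I : Set ι).pi u, mem_nhdsWithin_of_mem_nhds ?_, _, subset_rfl, hIU,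
    MeasurableSet.pi I.countable_toSet fun i hi => (hu i hi).1.measurableSet⟩
  exact set_pi_mem_nhds I.finite_toSet fun i hi => (hu i hi).1.mem_nhds (hu i hi).2

/-- A closed Haar null set in a power of a compact group is null for the product measure, even if
the product of the Borel σ-algebras is smaller than the Borel σ-algebra. -/
theorem HaarNull.measure_pi_eq_zero {B : Set (ι → G)} (hB : IsClosed B) (hnull : HaarNull B) :
    Measure.pi (fun _ => haarMeasure (⊤ : TopologicalSpace.PositiveCompacts G)) B = 0 := by
  have hle : (MeasurableSpace.pi : MeasurableSpace (ι → G)) ≤ borel (ι → G) :=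
    pi_le_borel_pi.trans' (by simp [MeasurableSpace.pi, BorelSpace.measurable_eq])
  obtain ⟨ν, hp, hinv, hreg, hνB⟩ : ∃ ν : @Measure (ι → G) (borel (ι → G)),
      @IsProbabilityMeasure _ (borel _) ν ∧ @IsMulLeftInvariant _ (borel _) _ ν ∧
      @OuterRegular _ (borel _) _ ν ∧ ν B = 0 := by
    let : MeasurableSpace (ι → G) := borel (ι → G)
    have : BorelSpace (ι → G) := ⟨rfl⟩
    exact ⟨haarMeasure ⊤, inferInstance, inferInstance, inferInstance, hnull.measure_eq_zero _⟩
  have hpt : IsProbabilityMeasure (ν.trim hle) := ⟨by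
    rw [trim_measurableSet_eq hle MeasurableSet.univ]; exact @measure_univ _ (borel _) ν hp⟩
  have hinvt : (ν.trim hle).IsMulLeftInvariant := by
    refine ⟨fun g => ?_⟩
    ext A hA
    have hm : Measurable fun γ : ι → G => g * γ := measurable_const_mul g
    rw [map_apply hm hA, trim_measurableSet_eq hle hA, trim_measurableSet_eq hle (hm hA)]
    let : MeasurableSpace (ι → G) := borel (ι → G)
    have : BorelSpace (ι → G) := ⟨rfl⟩
    exact measure_preimage_mul ν g A
  rw [pi_haarMeasure_eq_of_isMulLeftInvariant (ν.trim hle), ← nonpos_iff_eq_zero]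
  refine ENNReal.le_of_forall_pos_le_add fun ε hε _ => ?_
  obtain ⟨U, hBU, hU, hUε⟩ := @Set.exists_isOpen_lt_of_lt _ (borel _) ν _ hreg B ε
    (by rw [hνB]; exact_mod_cast hε)
  -- `U` need not be measurable for the product σ-algebra; a finite union of boxes between `B` and
  -- `U` is.
  obtain ⟨V, hBV, hVU, hV⟩ := hB.isCompact.exists_measurableSet_pi hU hBU
  calc ν.trim hle B ≤ ν.trim hle V := measure_mono hBV
    _ = ν V := trim_measurableSet_eq hle hV
    _ ≤ ν U := by gcongr
    _ ≤ 0 + ε := by rw [zero_add]; exact hUε.le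

end PowerOfCompactGroup

/-! ### Pointwise stabilizers and their orbits. -/

section Stabilizers

open Set

variable {ι G X : Type*} [Group G] [MulAction G X]

/-- The tuples `γ` such that every `γ j` fixes `Y j` pointwise. -/
def tupleFixingSubgroup (G : Type*) [Group G] [MulAction G X] (Y : ι → Set X) :
    Subgroup (ι → G) :=
  Subgroup.pi univ fun j => fixingSubgroup G (Y j)

theorem mem_tupleFixingSubgroup {Y : ι → Set X} {γ : ι → G} :
    γ ∈ tupleFixingSubgroup G Y ↔ ∀ j, ∀ y ∈ Y j, γ j • y = y := by
  simp [tupleFixingSubgroup, Subgroup.mem_pi, mem_fixingSubgroup_iff]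

theorem isClosed_tupleFixingSubgroup [TopologicalSpace G] [TopologicalSpace X] [T2Space X]
    [ContinuousSMul G X] (Y : ι → Set X) :
    IsClosed (tupleFixingSubgroup G Y : Set (ι → G)) := by
  have : (tupleFixingSubgroup G Y : Set (ι → G)) = ⋂ j, ⋂ y ∈ Y j, {γ | γ j • y = y} := by
    ext γ
    simp [mem_tupleFixingSubgroup]
  rw [this]
  exact isClosed_iInter fun j => isClosed_biInter fun y _ =>
    isClosed_eq ((continuous_apply j).smul continuous_const) continuous_const

instance [TopologicalSpace G] [CompactSpace G] [TopologicalSpace X] [T2Space X]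
    [ContinuousSMul G X] (Y : ι → Set X) : CompactSpace (tupleFixingSubgroup G Y) :=
  isCompact_iff_compactSpace.1 (isClosed_tupleFixingSubgroup Y).isCompact

/-- If the orbit `T` were finite, some `g` would fix `Y j` and `T \ {s}` pointwise but move `s`.
Then `g • s` lies in `T \ {s}` and is fixed by `g`, forcing `g • s = s`. -/
theorem Separates.infinite_range_smul (hsep : Separates G X) {Y : ι → Set X} {j : ι}
    (hY : (Y j).Finite) {s : X} (hs : s ∉ Y j) :
    (range fun h : tupleFixingSubgroup G Y => (h : ι → G) j • s).Infinite := by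
  classical
  intro hfin
  set T := range fun h : tupleFixingSubgroup G Y => (h : ι → G) j • s
  have hZ : (Y j ∪ T \ {s}).Finite := hY.union hfin.sdiff
  obtain ⟨g, hg, hgs⟩ := hsep.2 hZ.toFinset s (by simp [hs])
  rw [mem_fixingSubgroup_iff, hZ.coe_toFinset] at hg
  have hmem : Pi.mulSingle j g ∈ tupleFixingSubgroup G Y := by
    rw [mem_tupleFixingSubgroup]
    intro i y hy
    rcases eq_or_ne i j with rfl | hij
    · rw [Pi.mulSingle_eq_same]
      exact hg y (Or.inl hy)
    · rw [Pi.mulSingle_eq_of_ne hij, one_smul]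
  have hgT : g • s ∈ T := ⟨⟨_, hmem⟩, by simp⟩
  exact hgs (smul_left_cancel g (hg (g • s) (Or.inr ⟨hgT, hgs⟩)))

variable [DecidableEq ι]

theorem tupleFixingSubgroup_update_le (Y : ι → Set X) (j : ι) (c : X) :
    tupleFixingSubgroup G (Function.update Y j (insert c (Y j))) ≤ tupleFixingSubgroup G Y := by
  intro γ hγ
  rw [mem_tupleFixingSubgroup] at hγ ⊢
  intro i y hy
  refine hγ i y ?_
  rcases eq_or_ne i j with rfl | hij
  · rw [Function.update_self]; exact Or.inr hy
  · rwa [Function.update_of_ne hij]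

theorem smul_eq_of_mem_tupleFixingSubgroup_update {Y : ι → Set X} {j : ι} {c : X} {γ : ι → G}
    (hγ : γ ∈ tupleFixingSubgroup G (Function.update Y j (insert c (Y j)))) : γ j • c = c := by
  rw [mem_tupleFixingSubgroup] at hγ
  exact hγ j c (by rw [Function.update_self]; exact Or.inl rfl)

end Stabilizers

/-! ### Reduced lists of letters and bookkeeping of revealed values. -/

section Letters

open Set

variable {ι G X : Type*} [Group G] [MulAction G X]

/-- The value at `γ` of a letter `y_j`, `y_j⁻¹` or `v ∈ G`. -/
def letterValue (γ : ι → G) : (ι × Bool) ⊕ G → G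
  | .inl (j, true) => γ j
  | .inl (j, false) => (γ j)⁻¹
  | .inr v => v

/-- The value at `γ` of a list of letters, where the head of the list acts first. -/
def lettersValue (γ : ι → G) (l : List ((ι × Bool) ⊕ G)) : G :=
  (l.map (letterValue γ)).reverse.prod

@[simp] theorem lettersValue_nil (γ : ι → G) : lettersValue γ [] = 1 := rfl

@[simp] theorem lettersValue_cons (γ : ι → G) (c : (ι × Bool) ⊕ G) (l : List ((ι × Bool) ⊕ G)) :
    lettersValue γ (c :: l) = lettersValue γ l * letterValue γ c := by
  simp [lettersValue]

theorem lettersValue_flatten (γ : ι → G) (ls : List (List ((ι × Bool) ⊕ G))) :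
    lettersValue γ ls.flatten = (ls.map (lettersValue γ)).reverse.prod := by
  induction ls with
  | nil => rfl
  | cons a l ih =>
    rw [List.flatten_cons, List.map_cons, List.reverse_cons, List.prod_append, ← ih]
    simp [lettersValue]

theorem continuous_lettersValue [TopologicalSpace G] [IsTopologicalGroup G]
    (l : List ((ι × Bool) ⊕ G)) : Continuous fun γ : ι → G => lettersValue γ l := by
  induction l with
  | nil => exact continuous_const
  | cons c l ih =>
    simp only [lettersValue_cons]
    refine ih.mul ?_
    rcases c with ⟨j, _ | _⟩ | v
    · exact (continuous_apply j).inv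
    · exact continuous_apply j
    · exact continuous_const

/-- Two letters may be consecutive in a reduced list if they are neither inverse variables nor both
constants. -/
def LettersReduced : (ι × Bool) ⊕ G → (ι × Bool) ⊕ G → Prop
  | .inl a, .inl b => a.1 = b.1 → a.2 = b.2
  | .inr _, .inr _ => False
  | _, _ => True

/-- The point `p` has not been queried by the first letter of the list. Here the values of `γ j`
on `Y j` are known and given by `g j`, and `Z` is the set of points that have been met. -/
def IsFresh (x : X) (g : ι → G) (Y : ι → Set X) (Z : Set X) (p : X) :
    List ((ι × Bool) ⊕ G) → Prop
  | [] => p ≠ x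
  | .inl (j, true) :: _ => p ∉ Y j
  | .inl (j, false) :: _ => (g j)⁻¹ • p ∉ Y j
  | .inr v :: _ => v • p ∉ Z

/-- All points that are known to be related by the tuple `g` belong to the finite set `Z`. -/
structure IsRecord (x : X) (g : ι → G) (Y : ι → Set X) (Z : Set X) : Prop where
  finite : Z.Finite
  start_mem : x ∈ Z
  dom_subset : ∀ j, ∀ y ∈ Y j, y ∈ Z
  image_subset : ∀ j, ∀ y ∈ Y j, g j • y ∈ Z

variable {x p : X} {g : ι → G} {Y : ι → Set X} {Z : Set X}

/-- After a constant comes a variable or the end of the list, and everything these must avoid lies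
in `Z`. -/
theorem IsRecord.isFresh_of_smul_notMem (hR : IsRecord x g Y Z) {v : G} {l : List ((ι × Bool) ⊕ G)}
    (hl : List.IsChain LettersReduced (.inr v :: l)) (hp : p ∉ Z) : IsFresh x g Y Z p l := by
  rcases l with _ | ⟨⟨j, _ | _⟩ | v', l⟩
  · rintro rfl
    exact hp hR.start_mem
  · intro h
    have := hR.image_subset j _ h
    rw [smul_inv_smul] at this
    exact hp this
  · exact fun h => hp (hR.dom_subset j _ h)
  · simp [LettersReduced] at hl

/-- The points which the image of `p` under the letter before `l` has to avoid. -/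
def avoidSet (Z : Set X) (p : X) (l : List ((ι × Bool) ⊕ G)) : Set X :=
  insert p Z ∪ ⋃ v ∈ {v | Sum.inr v ∈ l}, v⁻¹ • insert p Z

theorem finite_avoidSet (hZ : Z.Finite) (p : X) (l : List ((ι × Bool) ⊕ G)) :
    (avoidSet Z p l).Finite := by
  refine (hZ.insert p).union (Set.Finite.biUnion ?_ fun v _ => (hZ.insert p).smul_set)
  exact (l.finite_toSet.preimage Sum.inr_injective.injOn)

variable [DecidableEq ι]

/-- Extending a record by the pair `(c, d)`, where `{c, d} = {p, b}`. -/
theorem IsRecord.extend (hR : IsRecord x g Y Z) {h : ι → G} (hh : h ∈ tupleFixingSubgroup G Y)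
    {j : ι} {b c : X} (hc : c ∈ ({p, b} : Set X)) (hd : (g * h) j • c ∈ ({p, b} : Set X)) :
    IsRecord x (g * h) (Function.update Y j (insert c (Y j))) (Z ∪ {p, b}) := by
  rw [mem_tupleFixingSubgroup] at hh
  refine ⟨hR.finite.union (by simp), Or.inl hR.start_mem, fun i y hy => ?_, fun i y hy => ?_⟩
  · rcases eq_or_ne i j with rfl | hij
    · rw [Function.update_self] at hy
      rcases hy with rfl | hy
      · exact Or.inr hc
      · exact Or.inl (hR.dom_subset i y hy)
    · rw [Function.update_of_ne hij] at hy
      exact Or.inl (hR.dom_subset i y hy)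
  · have hY : y ∈ Y i → (g * h) i • y ∈ Z ∪ {p, b} := fun hy => by
      rw [Pi.mul_apply, mul_smul, hh i y hy]
      exact Or.inl (hR.image_subset i y hy)
    rcases eq_or_ne i j with rfl | hij
    · rw [Function.update_self] at hy
      rcases hy with rfl | hy
      · exact Or.inr hd
      · exact hY hy
    · rw [Function.update_of_ne hij] at hy
      exact hY hy

/-- The step `p ↦ b` reveals `γ j` at `c`: `c = p` for `y_j`, and `c = b` for `y_j⁻¹`. Only the
inverse letter could retrace the new pair, and reducedness excludes it. -/
theorem IsRecord.isFresh_extend (hR : IsRecord x g Y Z) {h : ι → G}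
    (hh : h ∈ tupleFixingSubgroup G Y) {j : ι} {ε : Bool} {l : List ((ι × Bool) ⊕ G)} {b c : X}
    (hl : List.IsChain LettersReduced (.inl (j, ε) :: l))
    (hconst : ∀ v, Sum.inr v ∈ l → ∀ y : X, v • y ≠ y)
    (hb : b ∉ avoidSet Z p l) (hc : ε = true → c = p) (hd : ε = false → (g * h) j • c = p) :
    IsFresh x (g * h) (Function.update Y j (insert c (Y j))) (Z ∪ {p, b}) b l := by
  rw [mem_tupleFixingSubgroup] at hh
  have hbZ : b ∉ Z := fun h => hb (Or.inl (Or.inr h))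
  have hbp : b ≠ p := fun h => hb (Or.inl (Or.inl h))
  rcases l with _ | ⟨⟨i, ε'⟩ | v, l⟩
  · rintro rfl
    exact hbZ hR.start_mem
  · have hred : j = i → ε = ε' := (List.isChain_cons_cons.1 hl).1
    cases ε' with
    | true =>
      change b ∉ Function.update Y j (insert c (Y j)) i
      intro hy
      rcases eq_or_ne i j with rfl | hij
      · rw [Function.update_self] at hy
        rcases hy with rfl | hy
        · exact hbp (hc (hred rfl))
        · exact hbZ (hR.dom_subset i b hy)
      · rw [Function.update_of_ne hij] at hy
        exact hbZ (hR.dom_subset i b hy)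
    | false =>
      change ((g * h) i)⁻¹ • b ∉ Function.update Y j (insert c (Y j)) i
      have hY : ((g * h) i)⁻¹ • b ∉ Y i := fun hy => by
        have := hh i _ hy
        have h2 := hR.image_subset i _ hy
        rw [← this, smul_smul, smul_smul] at h2
        simp only [Pi.mul_apply, mul_inv_cancel, one_smul] at h2
        exact hbZ h2
      intro hy
      rcases eq_or_ne i j with rfl | hij
      · rw [Function.update_self] at hy
        rcases hy with hy | hy
        · exact hbp ((inv_smul_eq_iff.1 hy).trans (hd (hred rfl)))
        · exact hY hy
      · rw [Function.update_of_ne hij] at hy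
        exact hY hy
  · change v • b ∉ Z ∪ {p, b}
    have hv : v • b ∉ insert p Z := fun h => hb (Or.inr (mem_biUnion (x := v) (by simp)
      (by rwa [mem_inv_smul_set_iff])))
    rintro (h | h | h)
    · exact hv (Or.inr h)
    · exact hv (Or.inl h)
    · exact hconst v (by simp) b h

end Letters

/-! ### Almost sure behaviour of the trajectory. -/

section Trajectory

open Set

/-- Conjugation by `h⁻¹`, from the stabilizer of `h • b` onto the stabilizer of `b`. -/
theorem HaarNull.conj {ι G X : Type*} [DecidableEq ι] [Group G] [TopologicalSpace G]
    [IsTopologicalGroup G] [MulAction G X] {Y : ι → Set X} {j : ι} {b q : X} {h : ι → G}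
    (hh : h ∈ tupleFixingSubgroup G Y) (hq : h j • b = q) {B : Set (ι → G)}
    (hB : HaarNull
      {k : tupleFixingSubgroup G (Function.update Y j (insert b (Y j))) | h * (k : ι → G) ∈ B}) :
    HaarNull
      {k : tupleFixingSubgroup G (Function.update Y j (insert q (Y j))) | (k : ι → G) * h ∈ B} := by
  have key (c d : X) (k : ι → G) (h : ι → G) (hh : h ∈ tupleFixingSubgroup G Y) (hc : h j • c = d)
      (hk : k ∈ tupleFixingSubgroup G (Function.update Y j (insert d (Y j)))) :
      h⁻¹ * k * h ∈ tupleFixingSubgroup G (Function.update Y j (insert c (Y j))) := by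
    have hfix := smul_eq_of_mem_tupleFixingSubgroup_update hk
    have hmem := mul_mem (mul_mem (inv_mem hh) (tupleFixingSubgroup_update_le Y j d hk)) hh
    rw [mem_tupleFixingSubgroup] at hmem ⊢
    intro i y hy
    rcases eq_or_ne i j with rfl | hij
    · rw [Function.update_self] at hy
      rcases hy with rfl | hy
      · rw [Pi.mul_apply, Pi.mul_apply, mul_smul, mul_smul, hc, hfix, ← hc, Pi.inv_apply,
          inv_smul_smul]
      · exact hmem i y hy
    · rw [Function.update_of_ne hij] at hy
      exact hmem i y hy
  let f : tupleFixingSubgroup G (Function.update Y j (insert q (Y j))) →*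
      tupleFixingSubgroup G (Function.update Y j (insert b (Y j))) :=
    { toFun k := ⟨h⁻¹ * k * h, key b q k h hh hq k.2⟩
      map_one' := by ext; simp
      map_mul' k k' := by ext; simp [mul_assoc] }
  have hf : Continuous f := by
    refine Continuous.subtype_mk ?_ _
    fun_prop
  have hs : Function.Surjective f := by
    intro k
    refine ⟨⟨h⁻¹⁻¹ * k * h⁻¹, key q b k h⁻¹ (inv_mem hh) ?_ k.2⟩, ?_⟩
    · rw [← hq, Pi.inv_apply, inv_smul_smul]
    · ext; simp [f, mul_assoc]
  refine (hB.preimage f hf hs).mono fun k hk => ?_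
  change h * (h⁻¹ * k * h) ∈ B
  convert (show (k : ι → G) * h ∈ B from hk) using 1
  group

variable {ι G X : Type*} [Group G] [TopologicalSpace G] [IsTopologicalGroup G]
  [TopologicalSpace X] [T2Space X] [MulAction G X] [ContinuousSMul G X]

theorem isClosed_setOf_lettersValue_smul_eq (l : List ((ι × Bool) ⊕ G)) (p x : X) :
    IsClosed {γ : ι → G | lettersValue γ l • p = x} :=
  isClosed_singleton.preimage
    ((continuous_lettersValue l).smul continuous_const : Continuous fun γ => lettersValue γ l • p)

theorem haarNull_setOf_apply_smul_eq (hsep : Separates G X) {Y : ι → Set X} {j : ι}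
    (hY : (Y j).Finite) {s : X} (hs : s ∉ Y j) (q : X) :
    HaarNull {h : tupleFixingSubgroup G Y | (h : ι → G) j • s = q} :=
  haarNull_setOf_smul_eq ((Pi.evalMonoidHom (fun _ => G) j).comp (tupleFixingSubgroup G Y).subtype)
    ((continuous_apply j).comp continuous_subtype_val) (hsep.infinite_range_smul hY hs) q

/-- Almost every tuple compatible with a record moves the fresh point `p` along the letters of a
reduced list to a point different from `x`. -/
theorem haarNull_setOf_lettersValue_smul_eq [DecidableEq ι] [CompactSpace G]
    (hsep : Separates G X) (x : X)
    (l : List ((ι × Bool) ⊕ G)) (hl : l.IsChain LettersReduced)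
    (hconst : ∀ v, Sum.inr v ∈ l → ∀ y : X, v • y ≠ y) {g : ι → G} {Y : ι → Set X} {Z : Set X}
    {p : X} (hR : IsRecord x g Y Z) (hp : IsFresh x g Y Z p l) :
    HaarNull {h : tupleFixingSubgroup G Y | lettersValue (g * (h : ι → G)) l • p = x} := by
  induction l generalizing g Y Z p with
  | nil =>
    convert haarNull_empty
    ext h
    simpa [IsFresh] using hp
  | cons c l ih =>
    have hconst' : ∀ v, Sum.inr v ∈ l → ∀ y : X, v • y ≠ y :=
      fun v hv => hconst v (List.mem_cons_of_mem _ hv)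
    have hYfin (j : ι) : (Y j).Finite := hR.finite.subset (hR.dom_subset j)
    have hclosed : IsClosed {h : tupleFixingSubgroup G Y |
        lettersValue (g * (h : ι → G)) (c :: l) • p = x} :=
      (isClosed_setOf_lettersValue_smul_eq (c :: l) p x).preimage
        (continuous_const.mul continuous_subtype_val :
          Continuous fun h : tupleFixingSubgroup G Y => g * (h : ι → G))
    rcases c with ⟨j, _ | _⟩ | v
    · set q := (g j)⁻¹ • p
      have hq : q ∉ Y j := hp
      have hE : HaarNull (⋃ s ∈ avoidSet Z p l,
          {h : tupleFixingSubgroup G Y | (h : ι → G) j • s = q}) := by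
        refine HaarNull.biUnion_finite (finite_avoidSet hR.finite p l) fun s _ => ?_
        by_cases hs : s ∈ Y j
        · convert haarNull_empty
          ext h
          simp only [mem_ofPred_eq, mem_empty_iff_false, iff_false]
          rw [mem_tupleFixingSubgroup.1 h.2 j s hs]
          rintro rfl
          exact hq hs
        · exact haarNull_setOf_apply_smul_eq hsep (hYfin j) hs q
      let φ := Subgroup.inclusion (tupleFixingSubgroup_update_le (G := G) Y j q)
      have hφ : Continuous φ := continuous_subtype_val.subtype_mk _
      -- For `y_j⁻¹` the fibres are the `k * h` with `k` fixing `q`: all satisfy `(k * h) j • b =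
      -- q`. The induction hypothesis concerns `h * k` with `k` fixing `b`, hence `HaarNull.conj`.
      refine HaarNull.of_fibers hφ continuous_const hE hclosed (b := fun _ => 1) fun h hh => ?_
      simp only [mem_iUnion, not_exists] at hh
      set b := ((h : ι → G) j)⁻¹ • q with hb
      have hhb : (h : ι → G) j • b = q := smul_inv_smul _ _
      have hghb : (g * (h : ι → G)) j • b = p := by
        rw [Pi.mul_apply, mul_smul, hhb, smul_inv_smul]
      have hbS : b ∉ avoidSet Z p l := fun hbS => hh b hbS hhb
      have hIH := ih hl.tail hconst'
        (hR.extend h.2 (j := j) (b := b) (c := b) (by simp) (by rw [hghb]; simp))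
        (hR.isFresh_extend h.2 hl hconst' hbS (by simp) (fun _ => hghb))
      refine (HaarNull.conj h.2 hhb
        (B := {γ | lettersValue (g * γ) l • b = x}) ?_).mono fun k hk => ?_
      · simpa only [mul_assoc, mem_ofPred_eq] using hIH
      · have hkq := smul_eq_of_mem_tupleFixingSubgroup_update k.2
        simp only [mem_ofPred_eq, lettersValue_cons, letterValue, mul_smul] at hk ⊢
        convert hk using 2
        · simp [φ]
        · simp only [φ, Pi.mul_apply, Subgroup.coe_mul, Subgroup.coe_inclusion, mul_one,
            mul_inv_rev, mul_smul]
          rw [hb]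
          congr 1
          exact eq_inv_smul_iff.2 hkq
    · have hpY : p ∉ Y j := hp
      have hE : HaarNull (⋃ s ∈ avoidSet Z p l,
          {h : tupleFixingSubgroup G Y | (h : ι → G) j • p = (g j)⁻¹ • s}) :=
        HaarNull.biUnion_finite (finite_avoidSet hR.finite p l) fun s _ =>
          haarNull_setOf_apply_smul_eq hsep (hYfin j) hpY _
      let φ := Subgroup.inclusion (tupleFixingSubgroup_update_le (G := G) Y j p)
      have hφ : Continuous φ := continuous_subtype_val.subtype_mk _
      -- For `y_j` the fibres are the `h * k` with `k` fixing `p`, so `g * h` becomes the new `g`.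
      refine HaarNull.of_fibers continuous_const hφ hE hclosed (a := fun _ => 1) fun h hh => ?_
      simp only [mem_iUnion, not_exists] at hh
      set b := (g * (h : ι → G)) j • p with hb
      have hbS : b ∉ avoidSet Z p l := fun hbS => hh b hbS (by
        change _ = _
        rw [hb, Pi.mul_apply, mul_smul, inv_smul_smul])
      have hIH := ih hl.tail hconst'
        (hR.extend h.2 (j := j) (b := b) (c := p) (by simp) (by rw [← hb]; simp))
        (hR.isFresh_extend h.2 hl hconst' hbS (by simp) (by simp))
      refine hIH.mono fun k hk => ?_
      have hkp := smul_eq_of_mem_tupleFixingSubgroup_update k.2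
      simp only [mem_ofPred_eq, lettersValue_cons, letterValue, mul_smul] at hk ⊢
      convert hk using 2
      · simp [φ, mul_assoc]
      · rw [hb]
        simp only [φ, Pi.mul_apply, Subgroup.coe_mul, Subgroup.coe_inclusion, one_mul, mul_smul]
        rw [hkp]
    · have := ih hl.tail hconst' hR (p := v • p) (hR.isFresh_of_smul_notMem hl hp)
      simpa only [lettersValue_cons, letterValue, mul_smul] using this

/-- A nonempty reduced list of letters, whose constants have no fixed points, almost surely takes
a value that moves any given point. -/
theorem measure_pi_setOf_lettersValue_smul_eq [Fintype ι] [CompactSpace G]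
    [MeasurableSpace G] [BorelSpace G] (hsep : Separates G X) (x : X) {l : List ((ι × Bool) ⊕ G)}
    (hne : l ≠ []) (hl : l.IsChain LettersReduced)
    (hconst : ∀ v, Sum.inr v ∈ l → ∀ y : X, v • y ≠ y) :
    Measure.pi (fun _ : ι => haarMeasure (⊤ : TopologicalSpace.PositiveCompacts G))
      {γ | lettersValue γ l • x = x} = 0 := by
  classical
  refine HaarNull.measure_pi_eq_zero (isClosed_setOf_lettersValue_smul_eq l x x) ?_
  have hR : IsRecord x (1 : ι → G) (fun _ => ∅) {x} :=
    ⟨finite_singleton x, rfl, by simp, by simp⟩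
  have hp : IsFresh x (1 : ι → G) (fun _ => ∅) {x} x l := by
    rcases l with _ | ⟨⟨j, _ | _⟩ | v, l⟩
    · exact absurd rfl hne
    · simp [IsFresh]
    · simp [IsFresh]
    · exact hconst v (by simp) x
  let f : (ι → G) →* tupleFixingSubgroup G (fun _ : ι => (∅ : Set X)) :=
    (MonoidHom.id _).codRestrict _ fun γ => mem_tupleFixingSubgroup.2 (by simp)
  have h := (haarNull_setOf_lettersValue_smul_eq hsep x l hl hconst hR hp).preimage f
    (continuous_id.subtype_mk _) fun h => ⟨h, rfl⟩
  refine h.mono fun γ hγ => ?_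
  change lettersValue (1 * γ) l • x = x
  rwa [one_mul]

end Trajectory

/-! ### From words to reduced lists of letters. -/

namespace MixedWord

variable {t : ℕ} {G : Type*}

/-- The letters of a reduced word of the free group, in the order in which they act. -/
def freeLetters (G : Type*) (u : FreeGroup (Fin t)) : List ((Fin t × Bool) ⊕ G) :=
  u.toWord.reverse.map Sum.inl

theorem lettersValue_freeLetters [Group G] (γ : Fin t → G) (u : FreeGroup (Fin t)) :
    lettersValue γ (freeLetters G u) = FreeGroup.lift γ u := by
  conv_rhs => rw [← FreeGroup.mk_toWord (x := u), FreeGroup.lift_mk]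
  rw [lettersValue, freeLetters, List.map_map, List.map_reverse, List.reverse_reverse]
  congr 2
  ext ⟨j, _ | _⟩ <;> rfl

theorem isChain_freeLetters (u : FreeGroup (Fin t)) :
    (freeLetters G u).IsChain LettersReduced := by
  rw [freeLetters, List.isChain_map, List.isChain_reverse]
  exact FreeGroup.isReduced_toWord.imp fun a b h h' => (h h'.symm).symm

theorem freeLetters_ne_nil {u : FreeGroup (Fin t)} (hu : u ≠ 1) : freeLetters G u ≠ [] := by
  simpa [freeLetters] using hu

/-- The letters of the word `u_n v_n ⋯ u_1 v_1`, in the order in which they act. -/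
def formLetters {n : ℕ} (u : Fin n → FreeGroup (Fin t)) (v : Fin n → G) :
    List ((Fin t × Bool) ⊕ G) :=
  (List.ofFn fun i => Sum.inr (v i) :: freeLetters G (u i)).flatten

variable {n : ℕ} {u : Fin n → FreeGroup (Fin t)} {v : Fin n → G}

theorem exists_eq_of_inr_mem_formLetters {g : G} (hg : Sum.inr g ∈ formLetters u v) :
    ∃ i, v i = g := by
  obtain ⟨l, hl, hgl⟩ := List.mem_flatten.1 hg
  obtain ⟨i, rfl⟩ := (List.mem_ofFn' _ _).1 hl
  refine ⟨i, ?_⟩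
  simpa [freeLetters, eq_comm] using hgl

variable [Group G] {w : MixedWord t G}

theorem IsReducedForm.lettersValue_formLetters (h : w.IsReducedForm n u v) (γ : Fin t → G) :
    lettersValue γ (formLetters u v) = eval γ w := by
  rw [h.2.2, formLetters, lettersValue_flatten, map_list_prod, List.map_reverse, List.map_ofFn,
    List.map_ofFn]
  congr 3
  funext i
  simp [letterValue, lettersValue_freeLetters, eval]

/-- Each block starts with a constant, and every block but the last ends in a variable because its
`u i` is nontrivial. -/
theorem IsReducedForm.isChain_formLetters (h : w.IsReducedForm n u v) :
    (formLetters u v).IsChain LettersReduced := by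
  rw [formLetters, List.isChain_flatten (by simp [List.mem_ofFn])]
  refine ⟨?_, ?_⟩
  · intro l hl
    obtain ⟨i, rfl⟩ := (List.mem_ofFn' _ _).1 hl
    rw [List.isChain_cons]
    refine ⟨fun y hy => ?_, isChain_freeLetters (u i)⟩
    have : y ∈ freeLetters G (u i) := List.mem_of_mem_head? hy
    obtain ⟨a, _, rfl⟩ := List.mem_map.1 this
    trivial
  · rw [List.isChain_ofFn]
    intro i hi y hy z hz
    have hne := freeLetters_ne_nil (G := G) (h.2.1 ⟨i, by omega⟩ hi)
    rw [List.getLast?_cons_of_ne_nil hne] at hy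
    obtain ⟨a, _, rfl⟩ := List.mem_map.1 (List.mem_of_mem_getLast? hy)
    simp only [List.head?_cons, Option.mem_def, Option.some.injEq] at hz
    subst hz
    trivial

theorem smul_ne_of_regionOfConstants_eq_univ {X : Type*} [MulAction G X]
    (h : regionOfConstants X v = Set.univ) (i : Fin n) (y : X) : v i • y ≠ y := by
  have := Set.iInter_eq_univ.1 h i
  -- A translate of a support is everything only if the support is.
  rw [← Set.smul_set_univ (a := ((List.ofFn fun j => (v j)⁻¹).take i).prod),
    smul_left_cancel_iff] at this
  exact this.ge (Set.mem_univ y)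

end MixedWord

theorem corollary3p5 {G X : Type*} [Group G] [TopologicalSpace G] [IsTopologicalGroup G]
    [CompactSpace G] [MeasurableSpace G] [BorelSpace G]
    [TopologicalSpace X] [T2Space X] [MulAction G X] [ContinuousSMul G X]
    (hsep : Separates G X) (t : ℕ) (w : MixedWord t G)
    (hw : w.IsExplicitlyOscillating X) (hO : w.IsRegion (Set.univ : Set X)) :
    ∀ᵐ γ ∂(randomTuple t G), MixedWord.eval γ w ≠ 1 := by
  have : Infinite X := hsep.1
  obtain ⟨x⟩ : Nonempty X := inferInstance
  obtain ⟨l, hne, hl, hconst, hval⟩ : ∃ l : List ((Fin t × Bool) ⊕ G), l ≠ [] ∧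
      l.IsChain LettersReduced ∧ (∀ v, Sum.inr v ∈ l → ∀ y : X, v • y ≠ y) ∧
      ∀ γ, lettersValue γ l = MixedWord.eval γ w := by
    rcases hO with ⟨⟨u, rfl⟩, -⟩ | ⟨hfree, n, u, v, hred, hreg⟩
    · have hu : u ≠ 1 := fun h => hw.1 (by rw [h, map_one])
      exact ⟨_, MixedWord.freeLetters_ne_nil hu, MixedWord.isChain_freeLetters u,
        by simp [MixedWord.freeLetters],
        fun γ => by simp [MixedWord.lettersValue_freeLetters, MixedWord.eval]⟩
    · refine ⟨_, fun hnil => ?_, hred.isChain_formLetters, fun g hg => ?_,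
        hred.lettersValue_formLetters⟩
      · rcases n with _ | n
        · exact hw.1 (by simpa using hred.2.2)
        · simp [MixedWord.formLetters, List.ofFn_succ] at hnil
      · obtain ⟨i, rfl⟩ := MixedWord.exists_eq_of_inr_mem_formLetters hg
        exact MixedWord.smul_ne_of_regionOfConstants_eq_univ hreg.symm i
  rw [ae_iff]
  refine measure_mono_null (fun γ hγ => ?_)
    (measure_pi_setOf_lettersValue_smul_eq hsep x hne hl hconst)
  have h1 : MixedWord.eval γ w = 1 := by simpa using hγ
  change lettersValue γ l • x = x
  rw [hval, h1, one_smul]
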